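/- Call a Hausdorff topological group $G$ amenable if every jointly continuous action of $G$ on a nonempty compact Hausdorff space $X$ admits a $G$-invariant Borel probability measure. Automorphism groups of structures carry the pointwise convergence topology, in which the pointwise stabilizers of finite sets form a neighborhood basis at the identity. Let $\mathbf{S}(3)$ be the directed graph with vertex set $\{e^{iq} : q \in \mathbb{Q}\}$ in which there is an edge from $e^{iq_1}$ to $e^{iq_2}$ if and only if $q_2 - q_1 \in (2\pi m, 2\pi m + 2\pi/3)$ for some $m \in \mathbb{Z}$. A boron tree is a finite graph-theoretic tree in which each vertex has degree $1$ or $3$; the tree with a single vertex is also admitted, its vertex being regarded as a leaf. To a boron tree one associates the structure whose universe is its set of leaves, with the $4$-ary relation $R$ for which $R(a,b,c,d)$ holds if and only if $a,b,c,d$ are distinct and there are a path from $a$ to $b$ and a path from $c$ to $d$ which do not intersect. Let $\mathcal{B}$ be the class of all structures isomorphic to one of these, and let $\mathbf{T}$ be the Fraïssé limit of $\mathcal{B}$, that is, the structure, unique up to isomorphism, which is countable, is ultrahomogeneous (any isomorphism between finite substructures extends to an automorphism), and whose nonempty finite substructures are, up to isomorphism, exactly the members of $\mathcal{B}$. Theorem.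 The groups $\mathrm{Aut}(\mathbf{S}(3))$ and $\mathrm{Aut}(\mathbf{T})$ are not amenable. -/

import Mathlib

open FirstOrder MeasureTheory

universe u v w

namespace FirstOrder.Language.Equiv

variable {L : Language.{u, v}} {M : Type w} [L.Structure M]

/-- The automorphisms of a first-order structure form a group under composition. -/
instance instGroupAut : Group (M ≃[L] M) where
  mul f g := f.comp g
  one := Language.Equiv.refl L M
  inv f := f.symm
  mul_assoc _ _ _ := rfl
  one_mul _ := rfl
  mul_one _ := rfl
  inv_mul_cancel f := Language.Equiv.ext fun x => f.left_inv x

theorem aut_mul_apply (f g : M ≃[L] M) (x : M) : (f * g) x = f (g x) := rfl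

theorem aut_one_apply (x : M) : (1 : M ≃[L] M) x = x := rfl

theorem aut_inv_apply_self (f : M ≃[L] M) (x : M) : f⁻¹ (f x) = x := f.left_inv x

theorem aut_apply_inv_self (f : M ≃[L] M) (x : M) : f (f⁻¹ x) = x := f.right_inv x

/-- The pointwise convergence topology on the automorphism group of a structure `M`: the topology
induced from the product topology on `M → M`, where `M` is discrete. -/
instance instTopologicalSpaceAut : TopologicalSpace (M ≃[L] M) :=
  TopologicalSpace.induced (fun (g : M ≃[L] M) (x : M) => g x)
    (@Pi.topologicalSpace M (fun _ => M) fun _ => ⊥)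

/-- The sets `{h | h x = y}` are open. -/
theorem isOpen_setOf_aut_apply_eq (x y : M) : IsOpen {h : M ≃[L] M | h x = y} := by
  let : TopologicalSpace M := ⊥
  have : DiscreteTopology M := ⟨rfl⟩
  have h1 : Continuous (fun (g : M ≃[L] M) (x : M) => g x) := continuous_induced_dom
  exact (isOpen_discrete {y}).preimage ((continuous_apply x).comp h1)

/-- A map into the automorphism group is continuous as soon as the preimages of the sets
`{h | h x = y}` are open. -/
theorem continuous_aut_of_isOpen {Y : Type*} [TopologicalSpace Y] {F : Y → (M ≃[L] M)}
    (hF : ∀ x y : M, IsOpen {t : Y | F t x = y}) : Continuous F := by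
  let : TopologicalSpace M := ⊥
  have : DiscreteTopology M := ⟨rfl⟩
  refine continuous_induced_rng.2 (continuous_pi fun x => ?_)
  exact continuous_discrete_rng.2 fun y => hF x y

instance instIsTopologicalGroupAut : IsTopologicalGroup (M ≃[L] M) where
  continuous_mul := continuous_aut_of_isOpen fun x y => by
    have h : {t : (M ≃[L] M) × (M ≃[L] M) | (t.1 * t.2) x = y}
        = ⋃ z : M, {h : M ≃[L] M | h z = y} ×ˢ {h : M ≃[L] M | h x = z} := by
      ext t
      simp [aut_mul_apply]
    rw [h]
    exact isOpen_iUnion fun z =>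
      (isOpen_setOf_aut_apply_eq z y).prod (isOpen_setOf_aut_apply_eq x z)
  continuous_inv := continuous_aut_of_isOpen fun x y => by
    have h : {t : M ≃[L] M | t⁻¹ x = y} = {t : M ≃[L] M | t y = x} := by
      ext t
      constructor
      · rintro rfl
        exact aut_apply_inv_self t x
      · rintro rfl
        exact aut_inv_apply_self t y
    rw [h]
    exact isOpen_setOf_aut_apply_eq y x

instance instT2SpaceAut : T2Space (M ≃[L] M) := by
  let : TopologicalSpace M := ⊥
  have : DiscreteTopology M := ⟨rfl⟩
  have h1 : Continuous (fun (g : M ≃[L] M) (x : M) => g x) := continuous_induced_dom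
  exact T2Space.of_injective_continuous DFunLike.coe_injective h1

end FirstOrder.Language.Equiv

/-- A Hausdorff topological group `G` is amenable if every jointly continuous action of `G` on a
nonempty compact Hausdorff space `X` admits an invariant Borel probability measure. -/
def IsAmenableGroup (G : Type u) [Group G] [TopologicalSpace G] [IsTopologicalGroup G]
    [T2Space G] : Prop :=
  ∀ (X : Type u) [TopologicalSpace X] [CompactSpace X] [T2Space X] [Nonempty X]
    [MeasurableSpace X] [BorelSpace X] [MulAction G X] [ContinuousSMul G X],
    ∃ μ : Measure X, IsProbabilityMeasure μ ∧ ∀ g : G, μ.map (fun x => g • x) = μ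

/-- The relation symbols of the language of directed graphs: one binary symbol. -/
inductive DigraphRel : ℕ → Type
  | arrow : DigraphRel 2

/-- The language of directed graphs. -/
def digraphLanguage : FirstOrder.Language.{0, 0} := ⟨fun _ => Empty, DigraphRel⟩

/-- The vertex set of the directed graph `S(3)`: the points `e ^ (i q)` of the unit circle with
`q` rational. -/
def S3 : Type := {z : ℂ // ∃ q : ℚ, z = Complex.exp ((q : ℂ) * Complex.I)}

/-- The edge relation of `S(3)`: there is an edge from `e ^ (i q₁)` to `e ^ (i q₂)` if the latter
is less than `2π/3` radians counterclockwise from the former. -/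
def S3.Arrow (a b : S3) : Prop :=
  ∃ q₁ q₂ : ℚ, a.1 = Complex.exp ((q₁ : ℂ) * Complex.I) ∧
    b.1 = Complex.exp ((q₂ : ℂ) * Complex.I) ∧
    ∃ m : ℤ, (q₂ : ℝ) - (q₁ : ℝ) ∈
      Set.Ioo (2 * Real.pi * (m : ℝ)) (2 * Real.pi * (m : ℝ) + 2 * Real.pi / 3)

/-- `S(3)` as a first-order structure. -/
instance S3.instStructure : digraphLanguage.Structure S3 where
  funMap := fun f => Empty.elim f
  RelMap := fun r x =>
    match r, x with
    | DigraphRel.arrow, x => S3.Arrow (x 0) (x 1)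

/-- A boron tree: a finite tree in which each vertex has degree `1` or `3`. The tree with a single
vertex is admitted as the degenerate boron tree with one leaf. -/
def SimpleGraph.IsBoronTree {V : Type u} (G : SimpleGraph V) : Prop :=
  Finite V ∧ G.IsTree ∧
    (Subsingleton V ∨ ∀ x : V, (G.neighborSet x).ncard = 1 ∨ (G.neighborSet x).ncard = 3)

/-- The leaves of a boron tree: the vertices of degree `1` (of degree `0` for the single vertex of
the degenerate tree). -/
def SimpleGraph.BoronLeaf {V : Type u} (G : SimpleGraph V) : Type u :=
  {x : V // (G.neighborSet x).ncard ≤ 1}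

/-- The quaternary relation on the leaves of a tree: `a, b, c, d` are distinct, and there are a path
from `a` to `b` and a path from `c` to `d` which do not intersect. -/
def SimpleGraph.BoronRel {V : Type u} (G : SimpleGraph V) (a b c d : G.BoronLeaf) : Prop :=
  [a, b, c, d].Nodup ∧
    ∃ (p : G.Walk a.1 b.1) (q : G.Walk c.1 d.1),
      p.IsPath ∧ q.IsPath ∧ p.support.Disjoint q.support

/-- The relation symbols of the language of boron tree structures: one quaternary symbol. -/
inductive BoronRelSymbol : ℕ → Type
  | R : BoronRelSymbol 4

/-- The language of boron tree structures. -/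
def boronLanguage : FirstOrder.Language.{0, 0} := ⟨fun _ => Empty, BoronRelSymbol⟩

instance boronLanguage.instCountableFunctions : Countable (Σ l, boronLanguage.Functions l) :=
  have : IsEmpty (Σ l, boronLanguage.Functions l) := ⟨fun f => Empty.elim f.2⟩
  inferInstance

/-- The structure on the leaves of a boron tree. -/
instance SimpleGraph.BoronLeaf.instStructure {V : Type u} (G : SimpleGraph V) :
    boronLanguage.Structure G.BoronLeaf where
  funMap := fun f => Empty.elim f
  RelMap := fun r x =>
    match r, x with
    | BoronRelSymbol.R, x => G.BoronRel (x 0) (x 1) (x 2) (x 3)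

/-- The class of finite boron tree structures: the structures isomorphic to the structure on the
leaves of some boron tree. The empty structure is added because Mathlib's age of a relational
structure always contains it. -/
def boronClass : Set (CategoryTheory.Bundled.{w} boronLanguage.Structure) :=
  {M | IsEmpty M ∨ ∃ (V : Type) (G : SimpleGraph V), G.IsBoronTree ∧
    Nonempty (M ≃[boronLanguage] G.BoronLeaf)}

/-! Both groups are refuted in the same way. Let an amenable group act on a set with open
stabilizers. A nonempty closed invariant set of Boolean labellings of that set is a compact space
with a jointly continuous action, so it carries an invariant probability measure
(`IsAmenableGroup.exists_invariant_measure`). For each structure a set of labellings is chosen on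
which invariance contradicts additivity.

For `S(3)`, cut the circle at three points a third of a turn apart, and record for each pair which
vertex comes first modulo a third of a turn. For an arrow from `a` to `b`, "`b` before `a`" says
that the arc contains a cut. An arc split in two contains a cut exactly when one of its halves does,
and by `exists_aut_pair` all arrows have the same probability `p` of being cut, so `p = 2p` and `p =
0`. For nonadjacent `a` and `b`, with `c` on a path of arrows `a → c → b`, "`b` before `a`" forces a
cut between `a` and `c`, so it is null too. Its complement "`a` before `b`" has the same probability
by homogeneity, a contradiction.

For `T`, hang the tree from a root and record, for each triple, which point branches off towards the
root. By `exists_aut_cycle` each of the three answers has probability `1/3`. If an edge separates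
`a, b` from `c, d`, then "`a` or `b` in the triple `a, b, c`" and "`c` or `d` in the triple `c, d,
a`" put the root on opposite sides of that edge. These disjoint events (`not_rootSide_of_boronQuad`)
have probability `2/3` each, a contradiction. -/

/-! ### Invariant measures on closed sets of labellings. -/

namespace FirstOrder.Language.Equiv

variable {L : Language.{u, v}} {M : Type w} [L.Structure M]

/-- The tautological action of the automorphism group of a structure. -/
instance instMulActionAut : MulAction (M ≃[L] M) M where
  smul g x := g x
  one_smul _ := rfl
  mul_smul _ _ _ := rfl

theorem aut_smul_def (g : M ≃[L] M) (x : M) : g • x = g x := rfl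

theorem isOpen_setOf_aut_smul_eq (x y : M) : IsOpen {g : M ≃[L] M | g • x = y} :=
  isOpen_setOf_aut_apply_eq x y

end FirstOrder.Language.Equiv

theorem isOpen_setOf_smul_prod_eq {G A B : Type*} [TopologicalSpace G] [SMul G A] [SMul G B]
    (hA : ∀ x y : A, IsOpen {g : G | g • x = y}) (hB : ∀ x y : B, IsOpen {g : G | g • x = y})
    (x y : A × B) : IsOpen {g : G | g • x = y} := by
  have : {g : G | g • x = y} = {g : G | g • x.1 = y.1} ∩ {g : G | g • x.2 = y.2} := by
    ext g
    simp [Prod.ext_iff]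
  rw [this]
  exact (hA _ _).inter (hB _ _)

/-- A condition on finitely many coordinates of a point of a Cantor cube is closed. -/
theorem isClosed_setOf_coordinates {A : Type*} {n : ℕ} (v : Fin n → A)
    (p : (Fin n → Bool) → Prop) : IsClosed {r : A → Bool | p fun i => r (v i)} := by
  have h : Continuous fun (r : A → Bool) (i : Fin n) => r (v i) :=
    continuous_pi fun i => continuous_apply (v i)
  exact (isClosed_discrete {s | p s}).preimage h

/-- A nonempty closed invariant set of labellings of a set on which an amenable group acts with
open stabilizers carries an invariant probability measure. -/
theorem IsAmenableGroup.exists_invariant_measure {G : Type u} [Group G] [TopologicalSpace G]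
    [IsTopologicalGroup G] [T2Space G] (hG : IsAmenableGroup G) {A : Type u} [MulAction G A]
    (hA : ∀ x y : A, IsOpen {g : G | g • x = y}) {K : Set (A → Bool)} (hK : IsClosed K)
    (hne : K.Nonempty) (hinv : ∀ (g : G), ∀ r ∈ K, (fun x => r (g⁻¹ • x)) ∈ K) :
    ∃ (_ : MeasurableSpace K) (μ : Measure K), IsProbabilityMeasure μ ∧
      (∀ x, MeasurableSet {r : K | r.1 x = true}) ∧
      ∀ (g : G) (x : A), μ {r | r.1 (g • x) = true} = μ {r | r.1 x = true} := by
  let _ : MeasurableSpace K := borel K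
  have : BorelSpace K := ⟨rfl⟩
  have : CompactSpace K := isCompact_iff_compactSpace.1 hK.isCompact
  have : Nonempty K := hne.to_subtype
  let _ : MulAction G K :=
    { smul := fun g r => ⟨fun x => r.1 (g⁻¹ • x), hinv g r.1 r.2⟩
      one_smul := fun r => Subtype.ext <| funext fun x => by
        change r.1 ((1 : G)⁻¹ • x) = r.1 x
        simp
      mul_smul := fun g h r => Subtype.ext <| funext fun x => by
        change r.1 ((g * h)⁻¹ • x) = r.1 (h⁻¹ • g⁻¹ • x)
        rw [mul_inv_rev, mul_smul] }
  have hsmul : ∀ (g : G) (r : K) (x : A), (g • r).1 x = r.1 (g⁻¹ • x) := fun _ _ _ => rfl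
  have hcont (x : A) : Continuous fun r : K => r.1 x :=
    (continuous_apply x).comp continuous_subtype_val
  have : ContinuousSMul G K := by
    refine ⟨continuous_induced_rng.2 <| continuous_pi fun x => ?_⟩
    refine continuous_discrete_rng.2 fun b => ?_
    -- Splitting according to `z = g⁻¹ • x` writes the preimage as a union of boxes, open because
    -- stabilizers are; this gives joint continuity.
    have : (fun t : G × K => (t.1 • t.2).1 x) ⁻¹' {b}
        = ⋃ z : A, {g : G | g • z = x} ×ˢ {r : K | r.1 z = b} := by
      ext ⟨g, r⟩
      simp only [Set.mem_preimage, Set.mem_singleton_iff, hsmul, Set.mem_iUnion, Set.mem_prod,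
        Set.mem_ofPred_eq]
      constructor
      · intro h
        exact ⟨g⁻¹ • x, by simp, h⟩
      · rintro ⟨z, rfl, h⟩
        simpa using h
    change IsOpen ((fun t : G × K => (t.1 • t.2).1 x) ⁻¹' {b})
    rw [this]
    exact isOpen_iUnion fun z => (hA z x).prod ((isOpen_discrete {b}).preimage (hcont z))
  obtain ⟨μ, hμ, hμinv⟩ := hG K
  have hmeas (x : A) : MeasurableSet {r : K | r.1 x = true} :=
    ((isOpen_discrete {true}).preimage (hcont x)).measurableSet
  refine ⟨inferInstance, μ, hμ, hmeas, fun g x => ?_⟩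
  conv_rhs => rw [← hμinv g⁻¹]
  rw [Measure.map_apply (continuous_const_smul g⁻¹).measurable (hmeas x)]
  congr 1
  ext r
  simp [hsmul]

/-! ### Back-and-forth. -/

/-- A back-and-forth argument: let `K` be a relation between pairs of elements of a countable set.
If every finite partial map all of whose pairs are related by `K` can be extended to any point,
then it extends to a permutation all of whose pairs are related by `K`. -/
theorem exists_equiv_of_extension {A : Type*} [Countable A] {K : A × A → A × A → Prop}
    (heq : ∀ p q, K p q → (p.1 = q.1 ↔ p.2 = q.2)) (hsymm : ∀ p q, K p q → K q p)
    (hswap : ∀ p q, K p q → K p.swap q.swap)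
    (hext : ∀ s : Finset (A × A), (∀ p ∈ s, ∀ q ∈ s, K p q) → ∀ x, ∃ y,
      K (x, y) (x, y) ∧ ∀ p ∈ s, K p (x, y))
    (s : Finset (A × A)) (hs : ∀ p ∈ s, ∀ q ∈ s, K p q) :
    ∃ e : A ≃ A, (∀ p ∈ s, e p.1 = p.2) ∧ ∀ x y, K (x, e x) (y, e y) := by
  classical
  let P := {s : Finset (A × A) // ∀ p ∈ s, ∀ q ∈ s, K p q}
  have hins (f : P) (z : A × A) (hz : K z z) (h : ∀ p ∈ f.1, K p z) :
      ∀ p ∈ insert z f.1, ∀ q ∈ insert z f.1, K p q := by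
    simp only [Finset.mem_insert]
    rintro p (rfl | hp) q (rfl | hq)
    · exact hz
    · exact hsymm _ _ (h q hq)
    · exact h p hp
    · exact f.2 p hp q hq
  -- The cofinal sets ask for a given point in the domain or in the range. An ideal meeting these
  -- countably many sets is a directed family whose union is total and surjective; `heq` makes it
  -- single-valued and injective.
  let D : A ⊕ A → Order.Cofinal P
    | .inl x =>
      { carrier := {f | ∃ y, (x, y) ∈ f.1}
        isCofinal := fun f => by
          obtain ⟨y, hy, hf⟩ := hext f.1 f.2 x
          exact ⟨⟨_, hins f _ hy hf⟩, ⟨y, Finset.mem_insert_self _ _⟩, Finset.subset_insert _ _⟩ }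
    | .inr y =>
      { carrier := {f | ∃ x, (x, y) ∈ f.1}
        isCofinal := fun f => by
          obtain ⟨x, hx, hf⟩ := hext (f.1.image Prod.swap) (by
            simp only [Finset.mem_image]
            rintro _ ⟨p, hp, rfl⟩ _ ⟨q, hq, rfl⟩
            exact hswap _ _ (f.2 p hp q hq)) y
          exact ⟨⟨_, hins f (x, y) (hswap _ _ hx) fun p hp =>
            hswap _ _ (hf p.swap (Finset.mem_image_of_mem _ hp))⟩,
            ⟨x, Finset.mem_insert_self _ _⟩, Finset.subset_insert _ _⟩ }
  have := Encodable.ofCountable (A ⊕ A)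
  let I := Order.idealOfCofinals (⟨s, hs⟩ : P) D
  have hI1 (x : A) : ∃ y, ∃ f ∈ I, (x, y) ∈ f.1 := by
    obtain ⟨f, ⟨y, hy⟩, hf⟩ := Order.cofinal_meets_idealOfCofinals (⟨s, hs⟩ : P) D (.inl x)
    exact ⟨y, f, hf, hy⟩
  have hI2 (y : A) : ∃ x, ∃ f ∈ I, (x, y) ∈ f.1 := by
    obtain ⟨f, ⟨x, hx⟩, hf⟩ := Order.cofinal_meets_idealOfCofinals (⟨s, hs⟩ : P) D (.inr y)
    exact ⟨x, f, hf, hx⟩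
  have hIK (p q : A × A) (hp : ∃ f ∈ I, p ∈ f.1) (hq : ∃ f ∈ I, q ∈ f.1) : K p q := by
    obtain ⟨f, hf, hpf⟩ := hp
    obtain ⟨g, hg, hqg⟩ := hq
    obtain ⟨h, -, hfh, hgh⟩ := I.directed f hf g hg
    exact h.2 p (hfh hpf) q (hgh hqg)
  choose F hF using hI1
  choose B hB using hI2
  refine ⟨⟨F, B, fun x => ?_, fun y => ?_⟩, fun p hp => ?_, fun x y => hIK _ _ (hF x) (hF y)⟩
  · exact (heq _ _ (hIK _ _ (hB (F x)) (hF x))).2 rfl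
  · exact (heq _ _ (hIK _ _ (hF (B y)) (hB y))).1 rfl
  · exact (heq _ _ (hIK _ _ (hF p.1)
      ⟨⟨s, hs⟩, Order.mem_idealOfCofinals (⟨s, hs⟩ : P) D, hp⟩)).1 rfl

/-! ### Angles modulo a third of the circle, and homogeneity of `S(3)`. -/

namespace S3

theorem third_pos : (0 : ℝ) < 2 * Real.pi / 3 := by positivity

/-- The position of the angle `q` modulo a third of the circle. -/
noncomputable def pos (q : ℚ) : ℝ := toIcoMod third_pos 0 (q : ℝ)

/-- The third of the circle which contains the angle `q`. -/
noncomputable def third (q : ℚ) : ZMod 3 := (toIcoDiv third_pos 0 (q : ℝ) : ZMod 3)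

theorem pos_nonneg (q : ℚ) : 0 ≤ pos q := (toIcoMod_mem_Ico third_pos 0 (q : ℝ)).1

theorem pos_lt (q : ℚ) : pos q < 2 * Real.pi / 3 := by
  have h := (toIcoMod_mem_Ico third_pos 0 (q : ℝ)).2
  rwa [zero_add] at h

theorem pos_add (q : ℚ) :
    pos q + (toIcoDiv third_pos 0 (q : ℝ) : ℝ) * (2 * Real.pi / 3) = q := by
  rw [← zsmul_eq_mul]
  exact toIcoMod_add_toIcoDiv_zsmul third_pos 0 (q : ℝ)

theorem toIcoDiv_of_mem {q : ℚ} {k : ℤ} (h0 : 0 ≤ (q : ℝ) - k * (2 * Real.pi / 3))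
    (h1 : (q : ℝ) - k * (2 * Real.pi / 3) < 2 * Real.pi / 3) :
    toIcoDiv third_pos 0 (q : ℝ) = k :=
  toIcoDiv_eq_of_sub_zsmul_mem_Ico third_pos (by
    rw [zero_add, zsmul_eq_mul]
    exact ⟨h0, h1⟩)

/-- Irrationality of `π`. This is what makes `pos` injective and distinct rational angles distinct
vertices. -/
theorem eq_zero_of_mul_third {q : ℚ} {k : ℤ} (h : (q : ℝ) = k * (2 * Real.pi / 3)) : q = 0 := by
  rcases eq_or_ne k 0 with rfl | hk
  · simpa using h
  · refine absurd ⟨3 * q / (2 * k), ?_⟩ irrational_pi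
    have : (k : ℝ) ≠ 0 := by exact_mod_cast hk
    push_cast
    rw [h]
    field_simp

theorem pos_injective : Function.Injective pos := by
  intro q q' h
  have h1 := pos_add q
  have h2 := pos_add q'
  refine sub_eq_zero.1 (eq_zero_of_mul_third
    (k := toIcoDiv third_pos 0 (q : ℝ) - toIcoDiv third_pos 0 (q' : ℝ)) ?_)
  push_cast
  linear_combination h - h1 + h2

theorem pos_zero : pos 0 = 0 := by
  have h := toIcoDiv_of_mem (q := 0) (k := 0) (by simp) (by simpa using third_pos)
  have := pos_add 0
  rw [h] at this
  simpa using this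

theorem third_zero : third 0 = 0 := by
  have h := toIcoDiv_of_mem (q := 0) (k := 0) (by simp) (by simpa using third_pos)
  rw [third, h]
  simp

theorem pos_eq_zero_iff {q : ℚ} : pos q = 0 ↔ q = 0 := by
  rw [← pos_zero, pos_injective.eq_iff]

/-- Each of the three thirds is dense. -/
theorem exists_third_eq (l : ZMod 3) {x y : ℝ} (hx : 0 ≤ x) (hxy : x < y)
    (hy : y ≤ 2 * Real.pi / 3) : ∃ q, third q = l ∧ x < pos q ∧ pos q < y := by
  obtain ⟨k, rfl⟩ := ZMod.intCast_surjective l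
  obtain ⟨q, h1, h2⟩ := exists_rat_btwn (add_lt_add_left hxy (k * (2 * Real.pi / 3)))
  have h := toIcoDiv_of_mem (q := q) (k := k) (by linarith) (by linarith)
  have h3 := pos_add q
  rw [h] at h3
  exact ⟨q, by rw [third, h], by linarith, by linarith⟩

/-- The edge relation of `S(3)` on angles. -/
def AngleArrow (q₁ q₂ : ℚ) : Prop :=
  ∃ m : ℤ, (q₂ : ℝ) - (q₁ : ℝ) ∈
    Set.Ioo (2 * Real.pi * (m : ℝ)) (2 * Real.pi * (m : ℝ) + 2 * Real.pi / 3)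

/-- The difference of the angles is a multiple of `2π/3` plus a difference of positions, of absolute
value below `2π/3`. It falls in `(0, 2π/3)` modulo `2π` only if the thirds agree and the position
grows, or the third advances by one and the position drops. -/
theorem angleArrow_iff {q₁ q₂ : ℚ} : AngleArrow q₁ q₂ ↔
    (third q₂ = third q₁ ∧ pos q₁ < pos q₂) ∨ (third q₂ = third q₁ + 1 ∧ pos q₂ < pos q₁) := by
  have h1 := pos_add q₁
  have h2 := pos_add q₂
  have b1 := pos_lt q₁
  have b2 := pos_lt q₂
  have c1 := pos_nonneg q₁
  have c2 := pos_nonneg q₂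
  have hpi := third_pos
  simp only [third, AngleArrow, Set.mem_Ioo]
  set n₁ := toIcoDiv third_pos 0 (q₁ : ℝ)
  set n₂ := toIcoDiv third_pos 0 (q₂ : ℝ)
  rw [← h1, ← h2]
  have hz (k : ℤ) : (n₂ : ZMod 3) = n₁ + k ↔ ∃ m : ℤ, n₂ = n₁ + k + 3 * m := by
    have : (n₂ : ZMod 3) = n₁ + k ↔ ((n₁ + k : ℤ) : ZMod 3) = (n₂ : ℤ) := by
      push_cast
      exact eq_comm
    rw [this, ZMod.intCast_eq_intCast_iff_dvd_sub]
    constructor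
    · rintro ⟨m, hm⟩
      exact ⟨m, by push_cast at hm; linarith⟩
    · rintro ⟨m, hm⟩
      exact ⟨m, by push_cast; linarith⟩
  have hz0 := hz 0
  have hz1 := hz 1
  simp only [Int.cast_zero, add_zero, Int.cast_one] at hz0 hz1
  rw [hz0, hz1]
  constructor
  · rintro ⟨m, hm1, hm2⟩
    obtain ⟨k, hk⟩ : ∃ k, n₂ = n₁ + k + 3 * m := ⟨n₂ - n₁ - 3 * m, by ring⟩
    have hk' : (n₂ : ℝ) = n₁ + k + 3 * m := by exact_mod_cast hk
    rw [hk'] at hm1 hm2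
    have k0 : -1 < k := by
      have : (-1 : ℝ) < k := by
        by_contra! h
        nlinarith
      exact_mod_cast this
    have k2 : k < 2 := by
      have : (k : ℝ) < 2 := by
        by_contra! h
        nlinarith
      exact_mod_cast this
    obtain rfl | rfl : k = 0 ∨ k = 1 := by omega
    · refine Or.inl ⟨⟨m, by linarith⟩, ?_⟩
      push_cast at hm1 hm2
      linarith
    · refine Or.inr ⟨⟨m, hk⟩, ?_⟩
      push_cast at hm1 hm2
      linarith
  · rintro (⟨⟨m, hm⟩, h⟩ | ⟨⟨m, hm⟩, h⟩)
    · refine ⟨m, ?_⟩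
      rw [hm]
      push_cast
      constructor <;> linarith
    · refine ⟨m, ?_⟩
      rw [hm]
      push_cast
      constructor <;> linarith

theorem angleArrow_add_right (q₁ q₂ r : ℚ) : AngleArrow (q₁ + r) (q₂ + r) ↔ AngleArrow q₁ q₂ := by
  simp [AngleArrow]

theorem angleArrow_zero_left {q : ℚ} (hq : q ≠ 0) : AngleArrow 0 q ↔ third q = 0 := by
  have h := lt_of_le_of_ne (pos_nonneg q) (Ne.symm (mt pos_eq_zero_iff.1 hq))
  rw [angleArrow_iff, pos_zero, third_zero]
  simp [h, h.not_gt]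

theorem angleArrow_zero_right {q : ℚ} (hq : q ≠ 0) : AngleArrow q 0 ↔ third q = 2 := by
  have h := lt_of_le_of_ne (pos_nonneg q) (Ne.symm (mt pos_eq_zero_iff.1 hq))
  rw [angleArrow_iff, pos_zero, third_zero]
  simp only [h, h.not_gt, and_false, and_true, false_or]
  generalize third q = x
  revert x
  decide

/-- The stabilizer of the angle `0` acts transitively on each third. -/
theorem exists_equiv_fixing_zero {b c : ℚ} (hb : b ≠ 0) (hc : c ≠ 0) (h : third b = third c) :
    ∃ e : ℚ ≃ ℚ, e 0 = 0 ∧ e b = c ∧ ∀ x y, AngleArrow (e x) (e y) ↔ AngleArrow x y := by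
  have hb0 := lt_of_le_of_ne (pos_nonneg b) (Ne.symm (mt pos_eq_zero_iff.1 hb))
  have hc0 := lt_of_le_of_ne (pos_nonneg c) (Ne.symm (mt pos_eq_zero_iff.1 hc))
  -- Partial isomorphisms for the colouring by thirds and the order by position. The angle `0` is
  -- the only one at position `0`, hence the least; it must correspond to itself so that every other
  -- image leaves room below it.
  let K : ℚ × ℚ → ℚ × ℚ → Prop := fun p q =>
    (third p.1 = third p.2 ∧ third q.1 = third q.2) ∧
    ((p.1 = 0 ↔ p.2 = 0) ∧ (q.1 = 0 ↔ q.2 = 0)) ∧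
    (pos p.1 < pos q.1 ↔ pos p.2 < pos q.2) ∧ (pos q.1 < pos p.1 ↔ pos q.2 < pos p.2)
  have hsymm : ∀ p q, K p q → K q p := fun p q h =>
    ⟨h.1.symm, h.2.1.symm, h.2.2.2, h.2.2.1⟩
  obtain ⟨e, he, hK⟩ := exists_equiv_of_extension (K := K)
    (fun p q h => by
      rw [← pos_injective.eq_iff, ← pos_injective.eq_iff (a := p.2), le_antisymm_iff,
        le_antisymm_iff, ← not_lt, ← not_lt, ← not_lt, ← not_lt, h.2.2.1, h.2.2.2])
    hsymm
    (fun p q h => ⟨⟨h.1.1.symm, h.1.2.symm⟩, ⟨h.2.1.1.symm, h.2.1.2.symm⟩, h.2.2.1.symm,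
      h.2.2.2.symm⟩)
    (fun s hs x => by
      by_cases hx : ∃ p ∈ s, p.1 = x
      · obtain ⟨p, hp, rfl⟩ := hx
        exact ⟨p.2, hs p hp p hp, fun q hq => hs q hq p hp⟩
      rcases eq_or_ne x 0 with rfl | hx0
      · refine ⟨0, by simp [K], fun p hp => ?_⟩
        have := hs p hp p hp
        refine ⟨⟨this.1.1, rfl⟩, ⟨this.2.1.1, Iff.rfl⟩, ?_, ?_⟩
        · simp only [pos_zero, (pos_nonneg _).not_gt]
        · simp only [pos_zero, lt_iff_le_and_ne, pos_nonneg, true_and, ne_comm (a := (0 : ℝ)), ne_eq,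
            pos_eq_zero_iff, this.2.1.1]
      have hxpos := lt_of_le_of_ne (pos_nonneg x) (Ne.symm (mt pos_eq_zero_iff.1 hx0))
      let lo := insert 0 ((s.filter fun p => pos p.1 < pos x).image fun p => pos p.2)
      let hi := insert (2 * Real.pi / 3)
        ((s.filter fun p => pos x < pos p.1).image fun p => pos p.2)
      have hlh : ∀ a ∈ lo, ∀ b ∈ hi, a < b := by
        simp only [lo, hi, Finset.mem_insert, Finset.mem_image, Finset.mem_filter]
        rintro _ (rfl | ⟨p, ⟨hp, hpx⟩, rfl⟩) _ (rfl | ⟨q, ⟨hq, hqx⟩, rfl⟩)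
        · exact third_pos
        · refine lt_of_le_of_ne (pos_nonneg _) (Ne.symm (mt pos_eq_zero_iff.1 ?_))
          rw [← (hs q hq q hq).2.1.1]
          rintro h
          rw [h, pos_zero] at hqx
          exact hqx.not_ge (pos_nonneg _)
        · exact pos_lt _
        · exact (hs p hp q hq).2.2.1.1 (hpx.trans hqx)
      -- Choosing two separators `u < t` gives an open interval, inside `(0, 2π/3)`, in which the
      -- required third is dense.
      obtain ⟨u, hu1, hu2⟩ := Order.exists_between_finsets lo hi hlh
      obtain ⟨t, ht1, ht2⟩ := Order.exists_between_finsets {u} hi (by simpa using hu2)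
      obtain ⟨y, hy, hy1, hy2⟩ := exists_third_eq (third x)
        (hu1 0 (Finset.mem_insert_self _ _)).le (ht1 u (Finset.mem_singleton_self _))
        (ht2 _ (Finset.mem_insert_self _ _)).le
      have hy0 : y ≠ 0 := by
        rintro rfl
        rw [pos_zero] at hy1
        exact hy1.not_gt (hu1 0 (Finset.mem_insert_self _ _))
      refine ⟨y, by simp [K, hy, hx0, hy0], fun p hp => ?_⟩
      have hp' := hs p hp p hp
      refine ⟨⟨hp'.1.1, hy.symm⟩, ⟨hp'.2.1.1, by simp [hx0, hy0]⟩, ?_⟩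
      rcases lt_trichotomy (pos p.1) (pos x) with h | h | h
      · have : pos p.2 < pos y := (hu1 _ (Finset.mem_insert_of_mem (Finset.mem_image.2
          ⟨p, Finset.mem_filter.2 ⟨hp, h⟩, rfl⟩))).trans hy1
        simp [h, this, h.not_gt, this.not_gt]
      · exact absurd ⟨p, hp, pos_injective h⟩ hx
      · have : pos y < pos p.2 := hy2.trans (ht2 _ (Finset.mem_insert_of_mem (Finset.mem_image.2
          ⟨p, Finset.mem_filter.2 ⟨hp, h⟩, rfl⟩)))
        simp [h, this, h.not_gt, this.not_gt])
    {(0, 0), (b, c)}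
    (by simp [K, hb, hc, h, pos_zero, hb0, hc0, hb0.not_gt, hc0.not_gt])
  refine ⟨e, he (0, 0) (by simp), he (b, c) (by simp), fun x y => ?_⟩
  obtain ⟨⟨h1, h2⟩, -, h3, h4⟩ := hK x y
  simp only at h1 h2 h3 h4
  rw [angleArrow_iff, angleArrow_iff, ← h1, ← h2, ← h3, ← h4]

/-- The vertex of `S(3)` with the given angle. -/
noncomputable def point (q : ℚ) : S3 := ⟨Complex.exp ((q : ℂ) * Complex.I), q, rfl⟩

theorem exp_injective {q q' : ℚ}
    (h : Complex.exp ((q : ℂ) * Complex.I) = Complex.exp ((q' : ℂ) * Complex.I)) : q = q' := by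
  obtain ⟨n, hn⟩ := Complex.exp_eq_exp_iff_exists_int.1 h
  have h1 : (q : ℂ) = q' + n * (2 * Real.pi) := by
    have : (q : ℂ) * Complex.I = (q' + n * (2 * Real.pi)) * Complex.I := by rw [hn]; ring
    exact mul_right_cancel₀ Complex.I_ne_zero this
  have h2 : (q : ℝ) = q' + n * (2 * Real.pi) := by exact_mod_cast h1
  refine sub_eq_zero.1 (eq_zero_of_mul_third (k := 3 * n) ?_)
  push_cast
  rw [h2]
  ring

/-- The vertices of `S(3)` are parametrized by their angles. -/
noncomputable def pointEquiv : ℚ ≃ S3 :=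
  Equiv.ofBijective point ⟨fun _ _ h => exp_injective (congrArg Subtype.val h),
    fun ⟨_, q, hq⟩ => ⟨q, Subtype.ext hq.symm⟩⟩

theorem arrow_pointEquiv {q₁ q₂ : ℚ} :
    Arrow (pointEquiv q₁) (pointEquiv q₂) ↔ AngleArrow q₁ q₂ := by
  constructor
  · rintro ⟨q₁', q₂', h1, h2, h⟩
    rw [exp_injective h1, exp_injective h2]
    exact h
  · exact fun h => ⟨q₁, q₂, rfl, rfl, h⟩

/-- A permutation of the angles which preserves the edge relation induces an automorphism. -/
noncomputable def autOfEquiv (e : ℚ ≃ ℚ)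
    (he : ∀ x y, AngleArrow (e x) (e y) ↔ AngleArrow x y) : S3 ≃[digraphLanguage] S3 where
  toEquiv := (pointEquiv.symm.trans e).trans pointEquiv
  map_fun' := fun f => Empty.elim f
  map_rel' := fun r x => by
    cases r
    change Arrow (pointEquiv (e (pointEquiv.symm (x 0)))) (pointEquiv (e (pointEquiv.symm (x 1))))
      ↔ Arrow (x 0) (x 1)
    rw [arrow_pointEquiv, he, ← arrow_pointEquiv, Equiv.apply_symm_apply, Equiv.apply_symm_apply]

theorem autOfEquiv_apply (e : ℚ ≃ ℚ) (he : ∀ x y, AngleArrow (e x) (e y) ↔ AngleArrow x y)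
    (q : ℚ) : autOfEquiv e he (pointEquiv q) = pointEquiv (e q) := by
  change pointEquiv (e (pointEquiv.symm (pointEquiv q))) = _
  rw [Equiv.symm_apply_apply]

/-- `S(3)` is homogeneous for pairs of distinct vertices. -/
theorem exists_aut_pair {a b a' b' : S3} (hab : a ≠ b) (hab' : a' ≠ b')
    (h1 : Arrow a b ↔ Arrow a' b') (h2 : Arrow b a ↔ Arrow b' a') :
    ∃ g : S3 ≃[digraphLanguage] S3, g a = a' ∧ g b = b' := by
  obtain ⟨a, rfl⟩ := pointEquiv.surjective a
  obtain ⟨b, rfl⟩ := pointEquiv.surjective b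
  obtain ⟨a', rfl⟩ := pointEquiv.surjective a'
  obtain ⟨b', rfl⟩ := pointEquiv.surjective b'
  have hb : b - a ≠ 0 := sub_ne_zero.2 fun h => hab (congrArg _ h.symm)
  have hb' : b' - a' ≠ 0 := sub_ne_zero.2 fun h => hab' (congrArg _ h.symm)
  simp only [arrow_pointEquiv] at h1 h2
  have e1 (a b : ℚ) : AngleArrow a b ↔ AngleArrow 0 (b - a) := by
    rw [← angleArrow_add_right 0 (b - a) a]
    simp
  have e2 (a b : ℚ) : AngleArrow b a ↔ AngleArrow (b - a) 0 := by
    rw [← angleArrow_add_right (b - a) 0 a]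
    simp
  rw [e1 a, e1 a', angleArrow_zero_left hb, angleArrow_zero_left hb'] at h1
  rw [e2 a, e2 a', angleArrow_zero_right hb, angleArrow_zero_right hb'] at h2
  -- Seen from `0`, the third is `0` for an outgoing arrow, `2` for an incoming one and `1`
  -- otherwise, so the two arrow relations determine it.
  have h3 : third (b - a) = third (b' - a') := by
    generalize third (b - a) = x at *
    generalize third (b' - a') = y at *
    revert x y
    decide
  obtain ⟨e, he0, heb, he⟩ := exists_equiv_fixing_zero hb hb' h3
  -- Rotate `a` to the angle `0`, apply `e`, and rotate `0` to `a'`.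
  refine ⟨autOfEquiv (((Equiv.addRight (-a)).trans e).trans (Equiv.addRight a')) fun x y => ?_,
    ?_, ?_⟩
  · simp [angleArrow_add_right, he]
  · rw [autOfEquiv_apply]
    simp [he0]
  · rw [autOfEquiv_apply]
    simp [← sub_eq_add_neg, heb]

/-! ### Nonamenability for `S(3)`. -/

theorem not_isAmenableGroup : ¬ IsAmenableGroup (S3 ≃[digraphLanguage] S3) := by
  intro hG
  -- Read `r (a, b)` as "`a` before `b`". The clauses are totality with antisymmetry, additivity of
  -- cuts along arcs, and the passage from a nonadjacent pair to an arrow. Only these are required,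
  -- not that `r` be an order.
  let K : Set (S3 × S3 → Bool) := {r | ∀ a b c : S3,
    (a ≠ b → (r (a, b) = true ↔ ¬ r (b, a) = true)) ∧
    (Arrow a b → Arrow b c → Arrow a c →
      (r (c, a) = true ↔ r (b, a) = true ∨ r (c, b) = true) ∧
        ¬ (r (b, a) = true ∧ r (c, b) = true)) ∧
    (a ≠ b → ¬ Arrow a b → ¬ Arrow b a → Arrow a c → Arrow c b →
      r (b, a) = true → r (c, a) = true)}
  have hK : IsClosed K := by
    simp only [K, Set.ofPred_forall]
    refine isClosed_iInter fun a => isClosed_iInter fun b => isClosed_iInter fun c => ?_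
    exact isClosed_setOf_coordinates ![(a, b), (b, a), (c, a), (c, b)] fun s =>
      (a ≠ b → (s 0 = true ↔ ¬ s 1 = true)) ∧
      (Arrow a b → Arrow b c → Arrow a c →
        (s 2 = true ↔ s 1 = true ∨ s 3 = true) ∧ ¬ (s 1 = true ∧ s 3 = true)) ∧
      (a ≠ b → ¬ Arrow a b → ¬ Arrow b a → Arrow a c → Arrow c b → s 1 = true → s 2 = true)
  have hne : K.Nonempty := by
    classical
    refine ⟨fun p => decide (pos (pointEquiv.symm p.1) < pos (pointEquiv.symm p.2)),
      fun a b c => ?_⟩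
    obtain ⟨a, rfl⟩ := pointEquiv.surjective a
    obtain ⟨b, rfl⟩ := pointEquiv.surjective b
    obtain ⟨c, rfl⟩ := pointEquiv.surjective c
    have hab : pos a = pos b → a = b := fun h => pos_injective h
    simp only [arrow_pointEquiv, angleArrow_iff, Equiv.symm_apply_apply, decide_eq_true_eq, ne_eq,
      pointEquiv.injective.eq_iff]
    generalize third a = x at *
    generalize third b = y at *
    generalize third c = z at *
    refine ⟨fun h => ?_, ?_, ?_⟩
    · have := mt hab h
      grind
    · have : ∀ x : ZMod 3, x ≠ x + 1 ∧ x ≠ x + 1 + 1 := by decide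
      grind
    · have : ∀ x y : ZMod 3, x = y ∨ y = x + 1 ∨ x = y + 1 := by decide
      have : ∀ x : ZMod 3, x ≠ x + 1 ∧ x ≠ x + 1 + 1 := by decide
      grind
  have harrow (g : S3 ≃[digraphLanguage] S3) (a b : S3) : Arrow (g a) (g b) ↔ Arrow a b :=
    g.map_rel DigraphRel.arrow ![a, b]
  have hinv : ∀ (g : S3 ≃[digraphLanguage] S3), ∀ r ∈ K, (fun x => r (g⁻¹ • x)) ∈ K := by
    intro g r hr a b c
    have := hr (g⁻¹ a) (g⁻¹ b) (g⁻¹ c)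
    rw [harrow, harrow, harrow, harrow, harrow, (g⁻¹).injective.ne_iff] at this
    exact this
  obtain ⟨_, μ, hμ, hmeas, hμinv⟩ := hG.exists_invariant_measure
    (isOpen_setOf_smul_prod_eq FirstOrder.Language.Equiv.isOpen_setOf_aut_smul_eq
      FirstOrder.Language.Equiv.isOpen_setOf_aut_smul_eq) hK hne hinv
  have hpair {a b a' b' : S3} (hab : a ≠ b) (hab' : a' ≠ b') (h1 : Arrow a b ↔ Arrow a' b')
      (h2 : Arrow b a ↔ Arrow b' a') :
      μ {r | r.1 (b, a) = true} = μ {r | r.1 (b', a') = true} := by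
    obtain ⟨g, rfl, rfl⟩ := exists_aut_pair hab hab' h1 h2
    exact (hμinv g (b, a)).symm
  have harr {q q' : ℚ} (h0 : (0 : ℝ) < q' - q) (h1 : (q' : ℝ) - q < 2) :
      Arrow (pointEquiv q) (pointEquiv q') := by
    rw [arrow_pointEquiv]
    refine ⟨0, ?_, ?_⟩ <;> push_cast <;> linarith [Real.pi_gt_three]
  -- The interval `(2.5, 3.5)` lies inside `(2π/3, 4π/3)`, where neither direction is an arrow.
  have hnarr {q q' : ℚ} (h0 : (2.5 : ℝ) < q' - q) (h1 : (q' : ℝ) - q < 3.5) :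
      ¬ Arrow (pointEquiv q) (pointEquiv q') ∧ ¬ Arrow (pointEquiv q') (pointEquiv q) := by
    simp only [arrow_pointEquiv]
    have hpi := Real.pi_gt_d2
    have hpi' := Real.pi_lt_d2
    constructor
    · rintro ⟨m, hm1, hm2⟩
      rcases le_or_gt m 0 with h | h
      · have : (m : ℝ) ≤ 0 := by exact_mod_cast h
        nlinarith
      · have : (1 : ℝ) ≤ m := by exact_mod_cast h
        nlinarith
    · rintro ⟨m, hm1, hm2⟩
      rcases le_or_gt 0 m with h | h
      · have : (0 : ℝ) ≤ m := by exact_mod_cast h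
        nlinarith
      · have : (m : ℝ) ≤ -1 := by exact_mod_cast (by omega : m ≤ -1)
        nlinarith
  have hnotsymm {a b : S3} (h : Arrow a b) : ¬ Arrow b a := by
    obtain ⟨a, rfl⟩ := pointEquiv.surjective a
    obtain ⟨b, rfl⟩ := pointEquiv.surjective b
    rw [arrow_pointEquiv, angleArrow_iff] at h ⊢
    have : ∀ x : ZMod 3, x ≠ x + 1 ∧ x ≠ x + 1 + 1 := by decide
    grind
  have hirr {a b : S3} (h : Arrow a b) : a ≠ b := by
    rintro rfl
    exact hnotsymm h h
  have harrpair {a b a' b' : S3} (h : Arrow a b) (h' : Arrow a' b') :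
      μ {r | r.1 (b, a) = true} = μ {r | r.1 (b', a') = true} :=
    hpair (hirr h) (hirr h') (iff_of_true h h') (iff_of_false (hnotsymm h) (hnotsymm h'))
  have h01 : Arrow (pointEquiv 0) (pointEquiv (1 / 2)) := harr (by norm_num) (by norm_num)
  have h12 : Arrow (pointEquiv (1 / 2)) (pointEquiv 1) := harr (by norm_num) (by norm_num)
  have h02 : Arrow (pointEquiv 0) (pointEquiv 1) := harr (by norm_num) (by norm_num)
  -- The arc from `0` to `1` is split at `1/2`; all three arcs are cut with equal probability, so `p
  -- = p + p` with `p` finite.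
  have hzero : μ {r | r.1 (pointEquiv 1, pointEquiv 0) = true} = 0 := by
    have hunion : {r : K | r.1 (pointEquiv 1, pointEquiv 0) = true} =
        {r | r.1 (pointEquiv (1 / 2), pointEquiv 0) = true} ∪
          {r | r.1 (pointEquiv 1, pointEquiv (1 / 2)) = true} := by
      ext r
      exact ((r.2 _ _ _).2.1 h01 h12 h02).1
    have hdisj : Disjoint {r : K | r.1 (pointEquiv (1 / 2), pointEquiv 0) = true}
        {r | r.1 (pointEquiv 1, pointEquiv (1 / 2)) = true} :=
      Set.disjoint_left.2 fun r h h' => ((r.2 _ _ _).2.1 h01 h12 h02).2 ⟨h, h'⟩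
    have h := measure_union (μ := μ) hdisj (hmeas _)
    rw [← hunion, ← harrpair h02 h01, ← harrpair h02 h12] at h
    have hfin := measure_ne_top μ {r | r.1 (pointEquiv 1, pointEquiv 0) = true}
    by_contra hne
    exact (ENNReal.lt_add_right hfin hne).ne h
  have h03 := hnarr (q := 0) (q' := 3) (by norm_num) (by norm_num)
  have hne03 : pointEquiv 0 ≠ pointEquiv 3 := by
    rw [pointEquiv.injective.ne_iff]
    norm_num
  have h04 : Arrow (pointEquiv 0) (pointEquiv (3 / 2)) := harr (by norm_num) (by norm_num)
  have h43 : Arrow (pointEquiv (3 / 2)) (pointEquiv 3) := harr (by norm_num) (by norm_num)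
  have hzero' : μ {r | r.1 (pointEquiv 3, pointEquiv 0) = true} = 0 := by
    refine measure_mono_null (fun r hr => ?_) ((harrpair h04 h02).trans hzero)
    exact (r.2 _ _ _).2.2 hne03 h03.1 h03.2 h04 h43 hr
  have hcompl : {r : K | r.1 (pointEquiv 3, pointEquiv 0) = true}ᶜ =
      {r | r.1 (pointEquiv 0, pointEquiv 3) = true} := by
    ext r
    exact ((r.2 _ _ (pointEquiv 0)).1 hne03).symm
  -- Complementary events, exchanged by an automorphism swapping the nonadjacent pair, would both be
  -- null.
  have h := prob_compl_eq_one_sub (μ := μ) (hmeas (pointEquiv 3, pointEquiv 0))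
  rw [hcompl, ← hpair hne03 hne03.symm (iff_of_false h03.1 h03.2) (iff_of_false h03.2 h03.1),
    hzero'] at h
  simp at h

end S3

/-! ### Sides of an edge in a tree and the four point condition. -/

namespace SimpleGraph.IsTree

variable {V : Type*} {G : SimpleGraph V}

theorem exists_adj_dist_add_one_eq (hG : G.IsTree) {x v : V} (hxv : x ≠ v) :
    ∃ w, G.Adj v w ∧ G.dist x w + 1 = G.dist x v := by
  obtain ⟨p, hp⟩ := hG.connected.exists_walk_length_eq_dist v x
  cases p with
  | nil => exact absurd rfl hxv
  | @cons _ w _ h q =>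
    refine ⟨w, h, ?_⟩
    have h1 := dist_le q
    have h2 := hG.dist_eq_dist_add_one_of_adj x h
    rw [Walk.length_cons, dist_comm (u := v)] at hp
    rw [dist_comm (u := w)] at h1
    omega

/-- In a tree, only one neighbour of a vertex is closer to a given vertex. -/
theorem eq_of_adj_of_dist_lt (hG : G.IsTree) {x v w w' : V} (h : G.Adj v w) (h' : G.Adj v w')
    (hw : G.dist x w < G.dist x v) (hw' : G.dist x w' < G.dist x v) : w = w' := by
  have key (w : V) (h : G.Adj v w) (hw : G.dist x w < G.dist x v) :
      ∃ p : G.Walk v x, p.IsPath ∧ p.snd = w := by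
    obtain ⟨p, hp⟩ := hG.connected.exists_walk_length_eq_dist w x
    refine ⟨p.cons h, Walk.isPath_of_length_eq_dist _ ?_, by simp⟩
    have h1 := hG.dist_eq_dist_add_one_of_adj x h
    rw [Walk.length_cons, hp, dist_comm (u := w), dist_comm (u := v)]
    omega
  obtain ⟨p, hp, rfl⟩ := key w h hw
  obtain ⟨q, hq, rfl⟩ := key w' h' hw'
  rw [(hG.existsUnique_path v x).unique hp hq]

/-- A walk which avoids `u` and starts on the side of `v` of the edge `uv` stays on that side. -/
theorem dist_lt_of_mem_support (hG : G.IsTree) {u v : V} (huv : G.Adj u v) {s t : V}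
    (p : G.Walk s t) (hu : u ∉ p.support) (hs : G.dist s v < G.dist s u) :
    ∀ z ∈ p.support, G.dist z v < G.dist z u := by
  induction p with
  | nil => simpa using hs
  | @cons s t _ h p ih =>
    simp only [Walk.support_cons, List.mem_cons, not_or] at hu ⊢
    have htu : t ≠ u := by
      rintro rfl
      exact hu.2 p.start_mem_support
    have ht : G.dist t v < G.dist t u := by
      -- If the step from `s` to `t` crossed to the side of `u` elsewhere than at `u`, then `s` and
      -- the neighbour `w` of `t` towards `u` would both be closer to `v` than `t`, hence equal,
      -- although `s` is farther from `u` than `t` and `w` is nearer.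
      by_contra! hlt
      obtain ⟨w, hw, hwd⟩ := hG.exists_adj_dist_add_one_eq htu.symm
      have h1 := hG.dist_eq_dist_add_one_of_adj s huv
      have h2 := hG.dist_eq_dist_add_one_of_adj t huv
      have h3 := hG.dist_eq_dist_add_one_of_adj u h
      have h4 := hG.dist_eq_dist_add_one_of_adj v h
      have h5 := hG.dist_eq_dist_add_one_of_adj w huv
      rw [dist_comm (u := u) (v := w), dist_comm (u := u) (v := t)] at hwd
      rw [dist_comm (u := u), dist_comm (u := u)] at h3
      rw [dist_comm (u := v), dist_comm (u := v)] at h4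
      have : s = w := hG.eq_of_adj_of_dist_lt (x := v) h.symm hw
        (by rw [dist_comm, dist_comm (u := v)]; omega)
        (by rw [dist_comm, dist_comm (u := v)]; omega)
      subst this
      omega
    rintro z (rfl | hz)
    · exact hs
    · exact ih hu.2 ht z hz

theorem dist_add_dist_of_mem_support {s t z : V} (p : G.Walk s t)
    (hp : p.length = G.dist s t) (hz : z ∈ p.support) :
    G.dist s z + G.dist z t ≤ G.dist s t := by
  classical
  have h1 := congrArg Walk.length (p.take_spec hz)
  rw [Walk.length_append] at h1
  have h2 := dist_le (p.takeUntil z hz)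
  have h3 := dist_le (p.dropUntil z hz)
  omega

/-- The distance between vertices on different sides of an edge. -/
theorem dist_eq_of_adj (hG : G.IsTree) {u v x y : V} (huv : G.Adj u v)
    (hx : G.dist x u < G.dist x v) (hy : G.dist y v < G.dist y u) :
    G.dist x y = G.dist x u + 1 + G.dist y v := by
  obtain ⟨p, hp⟩ := hG.connected.exists_walk_length_eq_dist x y
  have hv : v ∈ p.support := by
    by_contra hv
    exact hy.not_gt (hG.dist_lt_of_mem_support huv.symm p hv hx y p.end_mem_support)
  have h1 := dist_add_dist_of_mem_support p hp hv
  have h2 := hG.connected.dist_triangle (u := x) (v := v) (w := y)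
  have h3 := hG.dist_eq_dist_add_one_of_adj x huv
  rw [dist_comm (u := v)] at h1 h2
  omega

/-- Two disjoint walks in a tree are separated by an edge. -/
theorem exists_adj_separating (hG : G.IsTree) {a b c d : V} (p : G.Walk a b) (q : G.Walk c d)
    (h : p.support.Disjoint q.support) :
    ∃ u v, G.Adj u v ∧ G.dist a u < G.dist a v ∧ G.dist b u < G.dist b v ∧
      G.dist c v < G.dist c u ∧ G.dist d v < G.dist d u := by
  classical
  -- The separating edge leaves the first walk at its vertex nearest to `c`, towards `c`: the first
  -- walk avoids `v`, the second avoids `u`.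
  obtain ⟨u, hu, hmin⟩ := p.support.toFinset.exists_min_image (G.dist c)
    ⟨a, by simp⟩
  simp only [List.mem_toFinset] at hu hmin
  have hcu : c ≠ u := by
    rintro rfl
    exact h hu q.start_mem_support
  obtain ⟨v, huv, hv⟩ := hG.exists_adj_dist_add_one_eq hcu
  have hvp : v ∉ p.support := fun hvp => by
    have := hmin v hvp
    omega
  have huu : G.dist u u < G.dist u v := by
    rw [dist_self, dist_eq_one_iff_adj.2 huv]
    exact one_pos
  refine ⟨u, v, huv, ?_, ?_, by omega, ?_⟩
  · refine hG.dist_lt_of_mem_support huv.symm (p.takeUntil u hu).reverse (fun hmem => hvp ?_) huu a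
      (Walk.end_mem_support _)
    rw [Walk.support_reverse, List.mem_reverse] at hmem
    exact p.support_takeUntil_subset_support hu hmem
  · exact hG.dist_lt_of_mem_support huv.symm (p.dropUntil u hu)
      (fun hmem => hvp (p.support_dropUntil_subset_support hu hmem)) huu b (Walk.end_mem_support _)
  · exact hG.dist_lt_of_mem_support huv q (fun hmem => h hu hmem) (by omega) d q.end_mem_support

/-- The four point condition. -/
theorem dist_add_dist_of_disjoint (hG : G.IsTree) {a b c d : V} (p : G.Walk a b) (q : G.Walk c d)
    (h : p.support.Disjoint q.support) :
    G.dist a b + G.dist c d < G.dist a c + G.dist b d ∧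
      G.dist a c + G.dist b d = G.dist a d + G.dist b c := by
  obtain ⟨u, v, huv, ha, hb, hc, hd⟩ := hG.exists_adj_separating p q h
  have h1 := hG.connected.dist_triangle (u := a) (v := u) (w := b)
  have h2 := hG.connected.dist_triangle (u := c) (v := v) (w := d)
  rw [dist_comm (u := u)] at h1
  rw [dist_comm (u := v)] at h2
  rw [hG.dist_eq_of_adj huv ha hc, hG.dist_eq_of_adj huv ha hd, hG.dist_eq_of_adj huv hb hc,
    hG.dist_eq_of_adj huv hb hd]
  omega

/-- Vertices on the same side of an edge are joined by a path on that side. -/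
theorem exists_isPath_of_dist_lt (hG : G.IsTree) {u v x y : V}
    (hx : G.dist x v < G.dist x u) (hy : G.dist y v < G.dist y u) :
    ∃ p : G.Walk x y, p.IsPath ∧ ∀ z ∈ p.support, G.dist z v < G.dist z u := by
  classical
  have key (x : V) (hx : G.dist x v < G.dist x u) :
      ∃ p : G.Walk x v, ∀ z ∈ p.support, G.dist z v < G.dist z u := by
    obtain ⟨p, hp⟩ := hG.connected.exists_walk_length_eq_dist x v
    refine ⟨p, fun z hz => ?_⟩
    have h1 := dist_add_dist_of_mem_support p hp hz
    have h2 := hG.connected.dist_triangle (u := x) (v := z) (w := u)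
    omega
  obtain ⟨p, hp⟩ := key x hx
  obtain ⟨q, hq⟩ := key y hy
  refine ⟨(p.append q.reverse).bypass, Walk.bypass_isPath _, fun z hz => ?_⟩
  have := Walk.support_bypass_subset_support _ hz
  rw [Walk.mem_support_append_iff, Walk.support_reverse, List.mem_reverse] at this
  exact this.elim (hp z) (hq z)

theorem exists_disjoint_isPath (hG : G.IsTree) {u v a b c d : V} (huv : G.Adj u v)
    (ha : G.dist a v < G.dist a u) (hb : G.dist b v < G.dist b u)
    (hc : ¬ G.dist c v < G.dist c u) (hd : ¬ G.dist d v < G.dist d u) :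
    ∃ (p : G.Walk a b) (q : G.Walk c d),
      p.IsPath ∧ q.IsPath ∧ p.support.Disjoint q.support := by
  have h1 := hG.dist_ne_of_adj c huv
  have h2 := hG.dist_ne_of_adj d huv
  obtain ⟨p, hp, hp'⟩ := hG.exists_isPath_of_dist_lt ha hb
  obtain ⟨q, hq, hq'⟩ := hG.exists_isPath_of_dist_lt (x := c) (y := d) (u := v) (v := u)
    (by omega) (by omega)
  exact ⟨p, q, hp, hq, fun z hz hz' => (hp' z hz).not_gt (hq' z hz')⟩

end SimpleGraph.IsTree

/-! ### Quadruples of leaves in a boron tree. -/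

namespace SimpleGraph

variable {V : Type*} {G : SimpleGraph V}

open Classical in
/-- Four leaves of a boron tree are split in two pairs by some edge. -/
theorem IsBoronTree.exists_adj_card_filter (hG : G.IsBoronTree) (s : Finset V) (hs : s.card = 4)
    (hleaf : ∀ x ∈ s, (G.neighborSet x).ncard ≤ 1) :
    ∃ u v, G.Adj u v ∧ (s.filter fun x => G.dist x v < G.dist x u).card = 2 := by
  obtain ⟨hfin, hT, hdeg⟩ := hG
  have := Fintype.ofFinite V
  replace hdeg : ∀ x : V, (G.neighborSet x).ncard = 1 ∨ (G.neighborSet x).ncard = 3 := by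
    refine hdeg.resolve_left fun hsub => ?_
    have := Finset.card_le_one_of_subsingleton s
    omega
  have hunique (x : V) (hx : x ∈ s) (w w' : V) (hw : G.Adj x w) (hw' : G.Adj x w') : w = w' :=
    (Set.ncard_le_one (Set.toFinite _)).1 (hleaf x hx) w hw w' hw'
  -- Among the oriented edges with at least two of the four leaves ahead, one with fewest vertices
  -- ahead is taken. Its head has at most two further neighbours, each leading to at most one of the
  -- leaves, so exactly two are ahead.
  let P : Finset (V × V) := Finset.univ.filter fun e =>
    G.Adj e.1 e.2 ∧ 2 ≤ (s.filter fun x => G.dist x e.2 < G.dist x e.1).card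
  have hP : P.Nonempty := by
    obtain ⟨a, ha⟩ : s.Nonempty := Finset.card_pos.1 (by omega)
    obtain ⟨b, hb, hba⟩ := s.exists_mem_ne (by omega) a
    obtain ⟨w, haw, -⟩ := hT.exists_adj_dist_add_one_eq hba
    refine ⟨(a, w), Finset.mem_filter.2 ⟨Finset.mem_univ _, haw, ?_⟩⟩
    have hsub : s.erase a ⊆ s.filter fun x => G.dist x w < G.dist x a := by
      intro x hx
      rw [Finset.mem_erase] at hx
      obtain ⟨w', haw', hw'⟩ := hT.exists_adj_dist_add_one_eq hx.1
      obtain rfl := hunique a ha w w' haw haw'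
      exact Finset.mem_filter.2 ⟨hx.2, by omega⟩
    have := Finset.card_le_card hsub
    rw [Finset.card_erase_of_mem ha] at this
    exact le_trans (by omega) this
  obtain ⟨⟨u, v⟩, huv, hmin⟩ := P.exists_min_image
    (fun e => (Finset.univ.filter fun x => G.dist x e.2 < G.dist x e.1).card) hP
  simp only [P, Finset.mem_filter, Finset.mem_univ, true_and, Prod.forall] at huv hmin
  obtain ⟨huv, hcard⟩ := huv
  refine ⟨u, v, huv, le_antisymm ?_ hcard⟩
  have hnext (x : V) (hx : G.dist x v < G.dist x u) (hxv : x ≠ v) :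
      ∃ w, G.Adj v w ∧ w ≠ u ∧ G.dist x w < G.dist x v := by
    obtain ⟨w, hvw, hw⟩ := hT.exists_adj_dist_add_one_eq hxv
    refine ⟨w, hvw, ?_, by omega⟩
    rintro rfl
    omega
  have hsmall (w : V) (hvw : G.Adj v w) (hwu : w ≠ u) :
      (s.filter fun x => G.dist x w < G.dist x v).card ≤ 1 := by
    by_contra! hlt
    -- What lies ahead of `v → w` is contained in what lies ahead of `u → v` and omits `v`, against
    -- minimality.
    refine (hmin v w ⟨hvw, hlt⟩).not_gt (Finset.card_lt_card ?_)
    rw [Finset.ssubset_iff_of_subset]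
    · refine ⟨v, ?_, ?_⟩
      · simp [dist_eq_one_iff_adj.2 huv.symm]
      · simp
    · intro x hx
      simp only [Finset.mem_filter, Finset.mem_univ, true_and] at hx ⊢
      by_contra hxu
      have := hT.dist_ne_of_adj x huv
      exact hwu (hT.eq_of_adj_of_dist_lt hvw huv.symm hx (by omega))
  have hvs : v ∉ s := fun hvs => by
    obtain ⟨x, hx, hxv⟩ := Finset.exists_mem_ne hcard v
    obtain ⟨w, hvw, hwu, -⟩ := hnext x (Finset.mem_filter.1 hx).2 hxv
    exact hwu (hunique v hvs w u hvw huv.symm)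
  have hcover : (s.filter fun x => G.dist x v < G.dist x u) ⊆
      ((G.neighborSet v).toFinset.erase u).biUnion
        fun w => s.filter fun x => G.dist x w < G.dist x v := by
    intro x hx
    rw [Finset.mem_filter] at hx
    obtain ⟨w, hvw, hwu, hw⟩ := hnext x hx.2 fun h => hvs (h ▸ hx.1)
    exact Finset.mem_biUnion.2 ⟨w, by simp [hwu, hvw], Finset.mem_filter.2 ⟨hx.1, hw⟩⟩
  refine (Finset.card_le_card hcover).trans ((Finset.card_biUnion_le_card_mul _ _ 1 ?_).trans ?_)
  · intro w hw
    simp only [Finset.mem_erase, Set.mem_toFinset, mem_neighborSet] at hw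
    exact hsmall w hw.2 hw.1
  · rw [Finset.card_erase_of_mem (by simpa using huv.symm), ← Set.ncard_eq_toFinset_card']
    rcases hdeg v with h | h <;> omega

theorem BoronRel.symm_left {a b c d : G.BoronLeaf} (h : G.BoronRel a b c d) :
    G.BoronRel b a c d := by
  obtain ⟨hnd, p, q, hp, hq, hpq⟩ := h
  refine ⟨by grind, p.reverse, q, hp.reverse, hq, fun x hx => hpq ?_⟩
  simpa using hx

theorem BoronRel.swap {a b c d : G.BoronLeaf} (h : G.BoronRel a b c d) :
    G.BoronRel c d a b := by
  obtain ⟨hnd, p, q, hp, hq, hpq⟩ := h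
  exact ⟨by grind, q, p, hq, hp, hpq.symm⟩

theorem IsBoronTree.boronRel_or (hG : G.IsBoronTree) {a b c d : G.BoronLeaf}
    (h : [a, b, c, d].Nodup) :
    G.BoronRel a b c d ∨ G.BoronRel a c b d ∨ G.BoronRel a d b c := by
  classical
  have hinj : [a.1, b.1, c.1, d.1].Nodup := h.map Subtype.val_injective
  simp only [List.nodup_cons, List.mem_cons, List.not_mem_nil, or_false, not_or,
    not_false_eq_true, List.nodup_nil, and_true] at hinj
  obtain ⟨⟨hab, hac, had⟩, ⟨hbc, hbd⟩, hcd⟩ := hinj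
  obtain ⟨u, v, huv, hcard⟩ := hG.exists_adj_card_filter {a.1, b.1, c.1, d.1}
    (by simp [hab, hac, had, hbc, hbd, hcd]) (by
      simp only [Finset.mem_insert, Finset.mem_singleton]
      rintro _ (rfl | rfl | rfl | rfl)
      exacts [a.2, b.2, c.2, d.2])
  have hex {a b c d : G.BoronLeaf} (h : [a, b, c, d].Nodup)
      (ha : G.dist a.1 v < G.dist a.1 u) (hb : G.dist b.1 v < G.dist b.1 u)
      (hc : ¬ G.dist c.1 v < G.dist c.1 u) (hd : ¬ G.dist d.1 v < G.dist d.1 u) :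
      G.BoronRel a b c d := ⟨h, hG.2.1.exists_disjoint_isPath huv ha hb hc hd⟩
  have h1 : [a, c, b, d].Nodup := by grind
  have h2 : [a, d, b, c].Nodup := by grind
  have h3 : [b, c, a, d].Nodup := by grind
  have h4 : [b, d, a, c].Nodup := by grind
  have h5 : [c, d, a, b].Nodup := by grind
  by_cases ha : G.dist a.1 v < G.dist a.1 u <;> by_cases hb : G.dist b.1 v < G.dist b.1 u <;>
    by_cases hc : G.dist c.1 v < G.dist c.1 u <;> by_cases hd : G.dist d.1 v < G.dist d.1 u <;>
    simp [Finset.filter_insert, Finset.filter_singleton, ha, hb, hc, hd, hab, hac, had, hbc, hbd,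
      hcd] at hcard
  · exact Or.inl (hex h ha hb hc hd)
  · exact Or.inr (Or.inl (hex h1 ha hc hb hd))
  · exact Or.inr (Or.inr (hex h2 ha hd hb hc))
  · exact Or.inr (Or.inr (hex h3 hb hc ha hd).swap)
  · exact Or.inr (Or.inl (hex h4 hb hd ha hc).swap)
  · exact Or.inl (hex h5 hc hd ha hb).swap

end SimpleGraph

/-! ### Structures whose age is the class of boron tree structures. -/

instance boronLanguage.instIsRelational : boronLanguage.IsRelational :=
  fun _ => inferInstanceAs (IsEmpty Empty)

/-- The quaternary relation of a structure in the language of boron tree structures. -/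
def BoronQuad {T : Type u} [boronLanguage.Structure T] (a b c d : T) : Prop :=
  FirstOrder.Language.Structure.RelMap (L := boronLanguage) BoronRelSymbol.R ![a, b, c, d]

theorem Function.comp_vec_four {A : Type*} {B : Type*} (f : A → B) (a b c d : A) :
    f ∘ ![a, b, c, d] = ![f a, f b, f c, f d] := by
  ext i
  fin_cases i <;> rfl

theorem boronQuad_equiv {M : Type u} {N : Type v} [boronLanguage.Structure M]
    [boronLanguage.Structure N] (g : M ≃[boronLanguage] N) (a b c d : M) :
    BoronQuad (g a) (g b) (g c) (g d) ↔ BoronQuad a b c d := by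
  have h := g.map_rel BoronRelSymbol.R ![a, b, c, d]
  rwa [Function.comp_vec_four] at h

theorem SimpleGraph.boronQuad_iff {V : Type u} {G : SimpleGraph V} (a b c d : G.BoronLeaf) :
    BoronQuad a b c d ↔ G.BoronRel a b c d := Iff.rfl

section Age

variable {T : Type u} [boronLanguage.Structure T]

/-- Finite subsets of a structure whose age consists of boron tree structures are sets of leaves of
boron trees. -/
theorem exists_boronTree_of_age (hT : boronLanguage.age T = boronClass) (s : Finset T)
    (hs : s.Nonempty) : ∃ (V : Type) (G : SimpleGraph V) (f : T → G.BoronLeaf), G.IsBoronTree ∧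
      Set.InjOn f s ∧ ∀ a ∈ s, ∀ b ∈ s, ∀ c ∈ s, ∀ d ∈ s,
        (BoronQuad a b c d ↔ G.BoronRel (f a) (f b) (f c) (f d)) := by
  classical
  let N := FirstOrder.Language.Substructure.closure boronLanguage (s : Set T)
  have hN : ∀ {x}, x ∈ s → x ∈ N := fun hx =>
    FirstOrder.Language.Substructure.subset_closure hx
  have hage : CategoryTheory.Bundled.mk N ∈ boronLanguage.age T :=
    FirstOrder.Language.age.fg_substructure
      (FirstOrder.Language.Substructure.fg_closure s.finite_toSet)
  rw [hT] at hage
  obtain ⟨x₀, hx₀⟩ := hs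
  rcases hage with hemp | ⟨V, G, hG, ⟨φ⟩⟩
  · exact (hemp.false ⟨x₀, hN hx₀⟩).elim
  change N ≃[boronLanguage] G.BoronLeaf at φ
  -- The value outside `N` is arbitrary; only points of `s` matter.
  let f : T → G.BoronLeaf := fun x => if h : x ∈ N then φ ⟨x, h⟩ else φ ⟨x₀, hN hx₀⟩
  have hf {x : T} (hx : x ∈ s) : f x = φ ⟨x, hN hx⟩ := dif_pos (hN hx)
  refine ⟨V, G, f, hG, fun x hx y hy hxy => ?_, fun a ha b hb c hc d hd => ?_⟩
  · rw [hf hx, hf hy] at hxy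
    exact congrArg Subtype.val (φ.injective hxy)
  · rw [hf ha, hf hb, hf hc, hf hd, ← SimpleGraph.boronQuad_iff, boronQuad_equiv]
    have h := N.subtype.map_rel BoronRelSymbol.R
      ![⟨a, hN ha⟩, ⟨b, hN hb⟩, ⟨c, hN hc⟩, ⟨d, hN hd⟩]
    rwa [Function.comp_vec_four] at h

theorem BoronQuad.nodup (hT : boronLanguage.age T = boronClass) {a b c d : T}
    (h : BoronQuad a b c d) : [a, b, c, d].Nodup := by
  classical
  obtain ⟨V, G, f, -, -, hf⟩ := exists_boronTree_of_age hT {a, b, c, d} (by simp)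
  exact List.Nodup.of_map f ((hf a (by simp) b (by simp) c (by simp) d (by simp)).1 h).1

theorem BoronQuad.ne (hT : boronLanguage.age T = boronClass) {a b c d : T}
    (h : BoronQuad a b c d) : a ≠ b ∧ a ≠ c ∧ a ≠ d := by
  have := h.nodup hT
  grind

theorem BoronQuad.symm_left (hT : boronLanguage.age T = boronClass) {a b c d : T}
    (h : BoronQuad a b c d) : BoronQuad b a c d := by
  classical
  obtain ⟨V, G, f, -, -, hf⟩ := exists_boronTree_of_age hT {a, b, c, d} (by simp)
  rw [hf _ (by simp) _ (by simp) _ (by simp) _ (by simp)] at h ⊢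
  exact h.symm_left

theorem BoronQuad.swap (hT : boronLanguage.age T = boronClass) {a b c d : T}
    (h : BoronQuad a b c d) : BoronQuad c d a b := by
  classical
  obtain ⟨V, G, f, -, -, hf⟩ := exists_boronTree_of_age hT {a, b, c, d} (by simp)
  rw [hf _ (by simp) _ (by simp) _ (by simp) _ (by simp)] at h ⊢
  exact h.swap

theorem boronQuad_or (hT : boronLanguage.age T = boronClass) {a b c d : T}
    (h : [a, b, c, d].Nodup) : BoronQuad a b c d ∨ BoronQuad a c b d ∨ BoronQuad a d b c := by
  classical
  obtain ⟨V, G, f, hG, hinj, hf⟩ := exists_boronTree_of_age hT {a, b, c, d} (by simp)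
  rw [hf a (by simp) b (by simp) c (by simp) d (by simp),
    hf a (by simp) c (by simp) b (by simp) d (by simp),
    hf a (by simp) d (by simp) b (by simp) c (by simp)]
  refine hG.boronRel_or (List.Nodup.map_on (f := f) (fun x hx y hy hxy => ?_) h)
  exact hinj (by simpa using hx) (by simpa using hy) hxy

/-- On finite sets the quaternary relation satisfies the four point condition for some distance. -/
theorem exists_four_point (hT : boronLanguage.age T = boronClass) (s : Finset T)
    (hs : s.Nonempty) : ∃ D : T → T → ℕ, (∀ x y, D x y = D y x) ∧
      ∀ a ∈ s, ∀ b ∈ s, ∀ c ∈ s, ∀ d ∈ s, BoronQuad a b c d →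
        D a b + D c d < D a c + D b d ∧ D a c + D b d = D a d + D b c := by
  obtain ⟨V, G, f, hG, -, hf⟩ := exists_boronTree_of_age hT s hs
  refine ⟨fun x y => G.dist (f x).1 (f y).1, fun x y => SimpleGraph.dist_comm,
    fun a ha b hb c hc d hd h => ?_⟩
  obtain ⟨-, p, q, -, -, hpq⟩ := (hf a ha b hb c hc d hd).1 h
  exact hG.2.1.dist_add_dist_of_disjoint p q hpq

/-- The two splittings give opposite strict inequalities in the four point condition. -/
theorem BoronQuad.not_swap_middle (hT : boronLanguage.age T = boronClass) {a b c d : T}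
    (h : BoronQuad a b c d) : ¬ BoronQuad a c b d := by
  classical
  obtain ⟨D, -, hD⟩ := exists_four_point hT {a, b, c, d} (by simp)
  intro h'
  have h1 := hD a (by simp) b (by simp) c (by simp) d (by simp) h
  have h2 := hD a (by simp) c (by simp) b (by simp) d (by simp) h'
  omega

/-- `a` is on the root side of `b` and `c` when the tree is rooted at the leaf `t`. -/
def RootSide (t a b c : T) : Prop := a = t ∨ BoronQuad t a b c

/-- If `t` is one of the three points, it is the answer, as a quadruple with a repetition is never
related; otherwise four distinct leaves split in exactly one way. -/
theorem rootSide_exactly_one (hT : boronLanguage.age T = boronClass) (t : T) {a b c : T}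
    (h : [a, b, c].Nodup) :
    (RootSide t a b c ∨ RootSide t b c a ∨ RootSide t c a b) ∧
      ¬ (RootSide t a b c ∧ RootSide t b c a) ∧ ¬ (RootSide t b c a ∧ RootSide t c a b) ∧
      ¬ (RootSide t c a b ∧ RootSide t a b c) := by
  have hR : ∀ a b c : T, BoronQuad t a b c → BoronQuad t a c b := fun a b c h =>
    ((h.swap hT).symm_left hT).swap hT
  have hnd : ∀ a b c : T, BoronQuad t a b c → t ≠ a ∧ t ≠ b ∧ t ≠ c := fun a b c h => by
    have := h.nodup hT
    grind
  have hne : ∀ a b c : T, BoronQuad t a b c → ¬ BoronQuad t b a c := fun a b c h =>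
    h.not_swap_middle hT
  have hor : a ≠ t → b ≠ t → c ≠ t →
      BoronQuad t a b c ∨ BoronQuad t b a c ∨ BoronQuad t c a b := fun h1 h2 h3 =>
    boronQuad_or hT (by grind)
  unfold RootSide
  grind

/-- An edge separates `a, b` from `c, d`. The first alternative attaches `t` on the side of `a, b`,
the second on the side of `c, d`. Formally, the four point equalities and inequalities clash, apart
from the cases where `t` is one of the points. -/
theorem not_rootSide_of_boronQuad (hT : boronLanguage.age T = boronClass) (t : T) {a b c d : T}
    (h : BoronQuad a b c d) :
    ¬ ((RootSide t a b c ∨ RootSide t b c a) ∧ (RootSide t c d a ∨ RootSide t d a c)) := by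
  classical
  obtain ⟨D, hDs, hD⟩ := exists_four_point hT {t, a, b, c, d} (by simp)
  have h0 := hD a (by simp) b (by simp) c (by simp) d (by simp) h
  have h1 := hD t (by simp) a (by simp) b (by simp) c (by simp)
  have h2 := hD t (by simp) b (by simp) c (by simp) a (by simp)
  have h3 := hD t (by simp) c (by simp) d (by simp) a (by simp)
  have h4 := hD t (by simp) d (by simp) a (by simp) c (by simp)
  have e1 := hDs b a
  have e2 := hDs c a
  have e3 := hDs d a
  have e4 := hDs c b
  have e5 := hDs d b
  have e6 := hDs d c
  have hnd := h.nodup hT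
  have hx1 : ¬ BoronQuad a d b c := fun h' => by
    have := hD a (by simp) d (by simp) b (by simp) c (by simp) h'
    omega
  have hR {a b c d : T} (h : BoronQuad a b c d) : BoronQuad a b d c :=
    ((h.swap hT).symm_left hT).swap hT
  simp only [List.nodup_cons, List.mem_cons, List.not_mem_nil, or_false, not_or] at hnd
  rintro ⟨(rfl | ha) | (rfl | hb), (rfl | hc) | (rfl | hd)⟩
  · exact hnd.1.2.1 rfl
  · exact (hc.ne hT).2.2 rfl
  · exact hnd.1.2.2 rfl
  · exact (hd.ne hT).2.1 rfl
  · exact (ha.ne hT).2.2 rfl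
  · have := h1 ha
    have := h3 hc
    omega
  · exact hx1 (hR (hR (ha.symm_left hT)))
  · have := h1 ha
    have := h4 hd
    omega
  · exact hnd.2.1.1 rfl
  · have := h3 hc
    omega
  · exact hnd.2.1.2 rfl
  · have := h4 hd
    omega
  · exact (hb.ne hT).2.1 rfl
  · have := h2 hb
    have := h3 hc
    omega
  · have := h2 hb
    omega
  · have := h2 hb
    have := h4 hd
    omega

/-- A cyclic permutation of three points extends to an automorphism. -/
theorem exists_aut_cycle (hT : boronLanguage.age T = boronClass)
    (hU : boronLanguage.IsUltrahomogeneous T) {a b c : T} (h : [a, b, c].Nodup) :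
    ∃ g : T ≃[boronLanguage] T, g a = b ∧ g b = c ∧ g c = a := by
  classical
  let N := FirstOrder.Language.Substructure.closure boronLanguage ({a, b, c} : Set T)
  have hN (x : T) : x ∈ N ↔ x = a ∨ x = b ∨ x = c := by
    rw [FirstOrder.Language.Substructure.mem_closure_iff_of_isRelational]
    simp
  have hmem (x : N) : x.1 ∈ ({a, b, c} : Finset T) := by simpa using (hN x.1).1 x.2
  -- The relation needs four distinct points, so it is empty on three: every injection of `N` is an
  -- embedding.
  have hfalse (x : Fin 4 → N) (σ : Equiv.Perm T) :
      ¬ FirstOrder.Language.Structure.RelMap (L := boronLanguage) BoronRelSymbol.R fun i => σ (x i).1 := by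
    intro hR
    have hR' : BoronQuad (σ (x 0).1) (σ (x 1).1) (σ (x 2).1) (σ (x 3).1) := by
      unfold BoronQuad
      convert hR using 1
      ext i
      fin_cases i <;> rfl
    have hnd := List.Nodup.of_map (f := fun y : N => σ y.1) (l := [x 0, x 1, x 2, x 3])
      (hR'.nodup hT)
    have hnd' := hnd.map (Subtype.val_injective (p := (· ∈ N)))
    have h1 := List.toFinset_card_of_nodup hnd'
    have h2 : ([x 0, x 1, x 2, x 3].map Subtype.val).toFinset ⊆ ({a, b, c} : Finset T) := by
      intro y hy
      simp only [List.mem_toFinset, List.mem_map] at hy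
      obtain ⟨z, -, rfl⟩ := hy
      exact hmem z
    have h3 := Finset.card_le_card h2
    have h4 : ({a, b, c} : Finset T).card ≤ 3 := Finset.card_le_three
    simp only [List.length_map, List.length_cons, List.length_nil] at h1
    omega
  let σ : Equiv.Perm T := Equiv.swap a b * Equiv.swap b c
  let f : N ↪[boronLanguage] T :=
    { toFun := fun x => σ x.1
      inj' := fun x y hxy => Subtype.ext (σ.injective hxy)
      map_fun' := fun f => isEmptyElim f
      map_rel' := fun r x => by
        cases r
        exact iff_of_false (hfalse x σ) (hfalse x 1) }
  obtain ⟨g, hg⟩ := hU N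
    (FirstOrder.Language.Substructure.fg_closure (Set.toFinite _)) f
  have hgσ (x : T) (hx : x ∈ N) : g x = σ x :=
    (DFunLike.congr_fun hg (⟨x, hx⟩ : N)).symm
  simp only [List.nodup_cons, List.mem_cons, List.not_mem_nil, or_false, not_or,
    not_false_eq_true, List.nodup_nil, and_true] at h
  obtain ⟨⟨hab, hac⟩, hbc⟩ := h
  refine ⟨g, ?_, ?_, ?_⟩
  · rw [hgσ a ((hN a).2 (by simp)), Equiv.Perm.mul_apply, Equiv.swap_apply_of_ne_of_ne hab hac,
      Equiv.swap_apply_left]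
  · rw [hgσ b ((hN b).2 (by simp)), Equiv.Perm.mul_apply, Equiv.swap_apply_left,
      Equiv.swap_apply_of_ne_of_ne (Ne.symm hac) (Ne.symm hbc)]
  · rw [hgσ c ((hN c).2 (by simp)), Equiv.Perm.mul_apply, Equiv.swap_apply_right,
      Equiv.swap_apply_right]

end Age

/-! ### Nonamenability for `T`. -/

/-- The boron tree with four leaves. -/
def fourLeafTree : SimpleGraph (Fin 6) :=
  SimpleGraph.fromRel fun x y => (x, y) ∈ [(0, 4), (1, 4), (2, 5), (3, 5), (4, 5)]

instance : DecidableRel fourLeafTree.Adj := fun x y =>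
  inferInstanceAs (Decidable (x ≠ y ∧
    ((x, y) ∈ [(0, 4), (1, 4), (2, 5), (3, 5), (4, 5)] ∨
      (y, x) ∈ [((0 : Fin 6), (4 : Fin 6)), (1, 4), (2, 5), (3, 5), (4, 5)])))

theorem fourLeafTree_ncard (x : Fin 6) :
    (fourLeafTree.neighborSet x).ncard = if x ≤ 3 then 1 else 3 := by
  rw [Set.ncard_eq_toFinset_card']
  revert x
  decide

theorem fourLeafTree_isBoronTree : fourLeafTree.IsBoronTree := by
  refine ⟨inferInstance, ?_, Or.inr fun x => ?_⟩
  · rw [SimpleGraph.isTree_iff_connected_and_card]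
    constructor
    · have h4 : ∀ x, fourLeafTree.Reachable x 4 := by
        have h45 : fourLeafTree.Reachable 5 4 := SimpleGraph.Adj.reachable (by decide)
        intro x
        fin_cases x
        · exact SimpleGraph.Adj.reachable (by decide)
        · exact SimpleGraph.Adj.reachable (by decide)
        · exact (SimpleGraph.Adj.reachable (v := 5) (by decide)).trans h45
        · exact (SimpleGraph.Adj.reachable (v := 5) (by decide)).trans h45
        · rfl
        · exact h45
      exact ⟨fun x y => (h4 x).trans (h4 y).symm⟩
    · rw [Nat.card_eq_fintype_card, Nat.card_eq_fintype_card]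
      decide
  · rw [fourLeafTree_ncard]
    split_ifs <;> simp

theorem exists_boronQuad {T : Type u} [boronLanguage.Structure T]
    (hT : boronLanguage.age T = boronClass) : ∃ a b c d : T, BoronQuad a b c d := by
  -- The four leaves are lifted to the universe of `T`, where its age lives.
  let e : fourLeafTree.BoronLeaf ≃ ULift.{u} fourLeafTree.BoronLeaf := Equiv.ulift.symm
  let _ : boronLanguage.Structure (ULift.{u} fourLeafTree.BoronLeaf) := e.inducedStructure
  let φ : fourLeafTree.BoronLeaf ≃[boronLanguage] ULift.{u} fourLeafTree.BoronLeaf :=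
    e.inducedStructureEquiv
  have hmem : CategoryTheory.Bundled.mk (ULift.{u} fourLeafTree.BoronLeaf) ∈
      (boronClass : Set (CategoryTheory.Bundled.{u} boronLanguage.Structure)) :=
    Or.inr ⟨Fin 6, fourLeafTree, fourLeafTree_isBoronTree, ⟨φ.symm⟩⟩
  rw [← hT] at hmem
  obtain ⟨-, ⟨ψ⟩⟩ := hmem
  let leaf (i : Fin 6) (hi : i ≤ 3) : fourLeafTree.BoronLeaf :=
    ⟨i, by rw [fourLeafTree_ncard, if_pos hi]⟩
  let l : List fourLeafTree.BoronLeaf :=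
    [leaf 0 (by decide), leaf 1 (by decide), leaf 2 (by decide), leaf 3 (by decide)]
  have hl : l.Nodup := by
    refine List.Nodup.of_map Subtype.val ?_
    change [(0 : Fin 6), 1, 2, 3].Nodup
    decide
  have hl' : (l.map fun x => ψ (φ x)).Nodup := hl.map (ψ.injective.comp φ.injective)
  rcases boronQuad_or hT hl' with h | h | h
  exacts [⟨_, _, _, _, h⟩, ⟨_, _, _, _, h⟩, ⟨_, _, _, _, h⟩]

theorem not_isAmenableGroup_of_age_eq_boronClass {T : Type u} [boronLanguage.Structure T]
    (hT : boronLanguage.age T = boronClass) (hU : boronLanguage.IsUltrahomogeneous T) :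
    ¬ IsAmenableGroup (T ≃[boronLanguage] T) := by
  intro hG
  -- Read `r (a, b, c)` as "`a` branches off towards the root". Only cyclic rotations of a triple
  -- are compared, so symmetry in the last two arguments is not imposed.
  let K : Set (T × T × T → Bool) := {r | ∀ a b c d : T,
    ([a, b, c].Nodup →
      (r (a, b, c) = true ∨ r (b, c, a) = true ∨ r (c, a, b) = true) ∧
      ¬ (r (a, b, c) = true ∧ r (b, c, a) = true) ∧ ¬ (r (b, c, a) = true ∧ r (c, a, b) = true) ∧
      ¬ (r (c, a, b) = true ∧ r (a, b, c) = true)) ∧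
    (BoronQuad a b c d → ¬ ((r (a, b, c) = true ∨ r (b, c, a) = true) ∧
      (r (c, d, a) = true ∨ r (d, a, c) = true)))}
  have hK : IsClosed K := by
    simp only [K, Set.ofPred_forall]
    refine isClosed_iInter fun a => isClosed_iInter fun b => isClosed_iInter fun c =>
      isClosed_iInter fun d => ?_
    exact isClosed_setOf_coordinates ![(a, b, c), (b, c, a), (c, a, b), (c, d, a), (d, a, c)]
      fun s => ([a, b, c].Nodup → (s 0 = true ∨ s 1 = true ∨ s 2 = true) ∧
        ¬ (s 0 = true ∧ s 1 = true) ∧ ¬ (s 1 = true ∧ s 2 = true) ∧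
        ¬ (s 2 = true ∧ s 0 = true)) ∧
      (BoronQuad a b c d → ¬ ((s 0 = true ∨ s 1 = true) ∧ (s 3 = true ∨ s 4 = true)))
  obtain ⟨a, b, c, d, habcd⟩ := exists_boronQuad hT
  have hne : K.Nonempty := by
    classical
    -- Any leaf can serve as the root; `a` is merely at hand.
    refine ⟨fun p => decide (RootSide a p.1 p.2.1 p.2.2), fun x y z t => ?_⟩
    simp only [decide_eq_true_eq]
    exact ⟨rootSide_exactly_one hT a, not_rootSide_of_boronQuad hT a⟩
  have hinv : ∀ (g : T ≃[boronLanguage] T), ∀ r ∈ K, (fun x => r (g⁻¹ • x)) ∈ K := by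
    intro g r hr a b c d
    have := hr (g⁻¹ a) (g⁻¹ b) (g⁻¹ c) (g⁻¹ d)
    have hnd : [g⁻¹ a, g⁻¹ b, g⁻¹ c].Nodup ↔ [a, b, c].Nodup :=
      List.nodup_map_iff (f := fun x => g⁻¹ x) (g⁻¹).injective (l := [a, b, c])
    rw [boronQuad_equiv, hnd] at this
    exact this
  obtain ⟨_, μ, hμ, hmeas, hμinv⟩ := hG.exists_invariant_measure
    (isOpen_setOf_smul_prod_eq FirstOrder.Language.Equiv.isOpen_setOf_aut_smul_eq
      (isOpen_setOf_smul_prod_eq FirstOrder.Language.Equiv.isOpen_setOf_aut_smul_eq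
        FirstOrder.Language.Equiv.isOpen_setOf_aut_smul_eq)) hK hne hinv
  have hcycle {x y z : T} (h : [x, y, z].Nodup) :
      μ.real {r | r.1 (y, z, x) = true} = μ.real {r | r.1 (x, y, z) = true} := by
    obtain ⟨g, rfl, rfl, hg⟩ := exists_aut_cycle hT hU h
    have := hμinv g (x, g x, g (g x))
    rw [Prod.smul_mk, Prod.smul_mk, FirstOrder.Language.Equiv.aut_smul_def,
      FirstOrder.Language.Equiv.aut_smul_def, FirstOrder.Language.Equiv.aut_smul_def, hg] at this
    rw [Measure.real, Measure.real, this]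
  have hunion {x y z : T} (h : [x, y, z].Nodup) :
      μ.real ({r | r.1 (x, y, z) = true} ∪ {r | r.1 (y, z, x) = true}) =
        μ.real {r | r.1 (x, y, z) = true} + μ.real {r | r.1 (y, z, x) = true} :=
    measureReal_union (Set.disjoint_left.2 fun r h1 h2 =>
      ((r.2 x y z x).1 h).2.1 ⟨h1, h2⟩) (hmeas _)
  have hthird {x y z : T} (h : [x, y, z].Nodup) :
      μ.real ({r | r.1 (x, y, z) = true} ∪ {r | r.1 (y, z, x) = true}) = 2 / 3 := by
    have hyzx : [y, z, x].Nodup := by grind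
    have hcompl : ({r : K | r.1 (x, y, z) = true} ∪ {r | r.1 (y, z, x) = true})ᶜ =
        {r | r.1 (z, x, y) = true} := by
      ext r
      have := (r.2 x y z x).1 h
      simp only [Set.mem_compl_iff, Set.mem_union, Set.mem_ofPred_eq]
      tauto
    have h1 := probReal_compl_eq_one_sub (μ := μ) ((hmeas (x, y, z)).union (hmeas (y, z, x)))
    rw [hcompl, hunion h, hcycle hyzx, hcycle h] at h1
    rw [hunion h, hcycle h]
    linarith
  have hnd := habcd.nodup hT
  have hdisj : Disjoint ({r : K | r.1 (a, b, c) = true} ∪ {r | r.1 (b, c, a) = true})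
      ({r | r.1 (c, d, a) = true} ∪ {r | r.1 (d, a, c) = true}) :=
    Set.disjoint_left.2 fun r h1 h2 => (r.2 a b c d).2 habcd ⟨h1, h2⟩
  -- Two disjoint events of probability `2/3` would give `4/3 ≤ 1`.
  have hle := measureReal_union (μ := μ) hdisj ((hmeas (c, d, a)).union (hmeas (d, a, c))) ▸
    measureReal_le_one
  rw [hthird (by grind), hthird (by grind)] at hle
  norm_num at hle

theorem theorem1p1 :
    ¬ IsAmenableGroup (S3 ≃[digraphLanguage] S3) ∧
    ∀ (T : Type u) [boronLanguage.Structure T] [Countable T],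
      FirstOrder.Language.IsFraisseLimit boronClass T →
        ¬ IsAmenableGroup (T ≃[boronLanguage] T) :=
  ⟨S3.not_isAmenableGroup, fun _ _ _ h =>
    not_isAmenableGroup_of_age_eq_boronClass h.age h.ultrahomogeneous⟩
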